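/- Let $k$ be a field of characteristic $p\ge 3$ and let $\lambda=(a,b)$, $a\ge b$, be a two-part partition of $n=a+b$ such that $b=p^\beta$ for some integer $\beta\ge 0$ and $p^{\nu_p(a+1)}<b$, where $\nu_p$ is the $p$-adic valuation. Let $M^\lambda$ be the permutation module over $k$ spanned by the $\lambda$-tabloids, let $S^\lambda\subseteq M^\lambda$ be the Specht module (the span of the polytabloids), and for $0\le v\le b$ write $f_{(n-v,v)}\in M^{(n-v,v)}$ for the sum of all tabloids of the composition $(n-v,v)$, and $\psi_{1,v}\colon M^{\lambda}\to M^{(n-v,v)}$ for the linear map that sends a tabloid to the sum of all tabloids whose second row is a $v$-element subset of its second row. Let $u\in M^\lambda$ be the sum of all $\lambda$-tabloids whose top row contains the entries $1,2,\dots,a-b+1$. Then: 1. $H^1(\mathcal S_n,S^\lambda)\neq 0$. 2. $u$ is a Hemmer element: for every $0\le v<b$ the element $\psi_{1,v}(u)$ is a scalar multiple of $f_{(n-v,v)}$, for at least one such $v$ it is a non-zero multiple, and there is no scalar $c\in k$ such that $\psi_{1,v}(c f_\lambda-u)=0$ for all $0\le v<b$. 3. The subspace $\langle S^\lambda,u\rangle=S^\lambda+ku$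 of $M^\lambda$ is $\mathcal S_n$-stable and is a non-split extension of $S^\lambda$ by the trivial module: there is a short exact sequence $0\to S^\lambda\to\langle S^\lambda,u\rangle\to k\to 0$ of $k\mathcal S_n$-modules, whose first map is the inclusion, and which does not split. -/

import Mathlib

noncomputable section

namespace TwoPartSpecht

universe u

/-- A tabloid of shape `(n - b, b)`, with entries in `Fin n` (the element `i : Fin n` stands for the
label `i + 1`). A row equivalence class of tableaux of a two-row shape is determined by the set of
entries of its second row, and it is identified with this `b`-element set. For `n < 2 * b` these are
the tabloids of the composition `(n - b, b)`. The symmetric group acts by permuting the entries. -/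
abbrev Tabloid (n b : ℕ) : Type := Set.powersetCard (Fin n) b

instance (n b : ℕ) : Fintype (Tabloid n b) := Fintype.ofFinite _

/-- The permutation module `M^(n - b, b)` over `k`: formal sums of tabloids. -/
abbrev PermModule (k : Type u) [Field k] (n b : ℕ) : Type u := Tabloid n b →₀ k

/-- The action of the symmetric group on `M^(n - b, b)`. -/
def permRep (k : Type u) [Field k] (n b : ℕ) :
    Representation k (Equiv.Perm (Fin n)) (PermModule k n b) where
  toFun σ := Finsupp.lmapDomain k k (σ • ·)
  map_one' := by ext; simp
  map_mul' σ τ := by ext; simp [mul_smul]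

/-- `f_(n - b, b)`, the sum of all tabloids. -/
def sumTabloids (k : Type u) [Field k] (n b : ℕ) : PermModule k n b :=
  ∑ X : Tabloid n b, Finsupp.single X 1

open Classical in
/-- The homomorphism `ψ_{1,v} : M^(n - b, b) → M^(n - v, v)`, which sends a tabloid to the sum of all
the tabloids whose second row is a `v`-element subset of its second row. -/
def psi (k : Type u) [Field k] (n b v : ℕ) : PermModule k n b →ₗ[k] PermModule k n v :=
  Finsupp.linearCombination k fun X : Tabloid n b =>
    ∑ Y : Tabloid n v with Y.val ⊆ X.val, Finsupp.single Y 1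

/-- A tableau of shape `(a, b)`: a bijection from the set of entries to the cells of the diagram,
where `Sum.inl j` is the cell in column `j` of the first row, and `Sum.inr j` is the cell in
column `j` of the second row. -/
abbrev Tableau (a b : ℕ) : Type := Fin (a + b) ≃ Fin a ⊕ Fin b

/-- The column in which a cell lies. -/
def column {a b : ℕ} : Fin a ⊕ Fin b → ℕ :=
  Sum.elim (fun j => (j : ℕ)) (fun j => (j : ℕ))

/-- The tabloid `{t}` of a tableau `t`, that is, the set of entries in the second row of `t`. -/
def Tableau.tabloid {a b : ℕ} (t : Tableau a b) : Tabloid (a + b) b :=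
  ⟨Finset.univ.map (Function.Embedding.inr.trans t.symm.toEmbedding), by simp⟩

/-- The column stabilizer of a tableau: the permutations of the entries which keep every entry in
its column. -/
def Tableau.columnStabilizer {a b : ℕ} (t : Tableau a b) : Subgroup (Equiv.Perm (Fin (a + b))) where
  carrier := {π | ∀ x, column (t (π x)) = column (t x)}
  one_mem' := fun _ => rfl
  mul_mem' := fun {π ρ} hπ hρ x => (hπ (ρ x)).trans (hρ x)
  inv_mem' := fun {π} hπ x => by simpa using (hπ (π⁻¹ x)).symm

open Classical in
/-- The polytabloid `e_t = ∑ sgn(π) {π t}`, the sum being over the column stabilizer of `t`. -/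
def Tableau.polytabloid (k : Type u) [Field k] {a b : ℕ} (t : Tableau a b) :
    PermModule k (a + b) b :=
  ∑ π : Equiv.Perm (Fin (a + b)) with π ∈ t.columnStabilizer,
    Finsupp.single (π • t.tabloid) (((Equiv.Perm.sign π : ℤˣ) : ℤ) : k)

theorem tabloid_perm {a b : ℕ} (σ : Equiv.Perm (Fin (a + b))) (t : Tableau a b) :
    Tableau.tabloid (σ⁻¹.trans t) = σ • t.tabloid := by
  apply Subtype.ext
  ext x
  simp only [Tableau.tabloid, Finset.mem_map, Finset.mem_univ, true_and,
    Set.powersetCard.coe_smul, Finset.mem_smul_finset, exists_exists_eq_and]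
  rfl

theorem mem_columnStabilizer_perm {a b : ℕ} (σ π : Equiv.Perm (Fin (a + b))) (t : Tableau a b) :
    σ * π * σ⁻¹ ∈ Tableau.columnStabilizer (σ⁻¹.trans t) ↔ π ∈ t.columnStabilizer := by
  change (∀ x, column (t (σ⁻¹ (σ (π (σ⁻¹ x))))) = column (t (σ⁻¹ x))) ↔
    ∀ x, column (t (π x)) = column (t x)
  constructor
  · intro h x
    simpa using h (σ x)
  · intro h x
    simpa using h (σ⁻¹ x)

theorem permRep_polytabloid (k : Type u) [Field k] {a b : ℕ} (σ : Equiv.Perm (Fin (a + b)))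
    (t : Tableau a b) :
    permRep k (a + b) b σ (t.polytabloid k) = Tableau.polytabloid k (σ⁻¹.trans t) := by
  classical
  simp only [Tableau.polytabloid, map_sum]
  refine Finset.sum_equiv (MulAut.conj σ).toEquiv (fun π => ?_) (fun π _ => ?_)
  · simpa using (mem_columnStabilizer_perm σ π t).symm
  · have h : (σ * π * σ⁻¹) • Tableau.tabloid (σ⁻¹.trans t) = σ • π • t.tabloid := by
      rw [tabloid_perm, smul_smul, smul_smul]
      simp
    have hs : Equiv.Perm.sign (σ * π * σ⁻¹) = Equiv.Perm.sign π := by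
      rw [map_mul, map_mul, Equiv.Perm.sign_inv, mul_right_comm, Int.units_mul_self, one_mul]
    simp [permRep, h, hs]

/-- The Specht module `S^(a, b)`, for `b ≤ a`: the span of the polytabloids in `M^(a, b)`. -/
def specht (k : Type u) [Field k] (a b : ℕ) : Subrepresentation (permRep k (a + b) b) where
  toSubmodule := Submodule.span k (Set.range fun t : Tableau a b => t.polytabloid k)
  apply_mem_toSubmodule σ x hx := by
    induction hx using Submodule.span_induction with
    | mem x h =>
      obtain ⟨t, rfl⟩ := h
      change permRep k (a + b) b σ (t.polytabloid k) ∈ _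
      rw [permRep_polytabloid]
      exact Submodule.subset_span ⟨σ⁻¹.trans t, rfl⟩
    | zero => simp
    | add x y _ _ hx hy => rw [map_add]; exact add_mem hx hy
    | smul c x _ hx => rw [map_smul]; exact Submodule.smul_mem _ c hx

/-- The Specht module `S^(a, b)` as an object of the category of representations. Mathlib's group
cohomology wants the group in the universe of the field, hence the `ULift`, which does nothing
else to the symmetric group. -/
def spechtRep (k : Type u) [Field k] (a b : ℕ) :
    Rep.{u} k (ULift.{u} (Equiv.Perm (Fin (a + b)))) :=
  let ρ : Representation k (ULift.{u} (Equiv.Perm (Fin (a + b)))) (specht k a b).toSubmodule :=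
    (specht k a b).toRepresentation.comp MulEquiv.ulift.toMonoidHom
  Rep.of (X := (specht k a b).toSubmodule) ρ

/-- An element `w` of `M^(a, b)` is Hemmer if each `ψ_{1,v}(w)`, for `0 ≤ v < b`, is a multiple of
the sum of all tabloids, at least one of them a non-zero multiple, and there is no scalar `c` with
`ψ_{1,v}(c f_(a, b) - w) = 0` for all these `v`. -/
def IsHemmer (k : Type u) [Field k] (a b : ℕ) (w : PermModule k (a + b) b) : Prop :=
  (∀ v < b, ∃ c : k, psi k (a + b) b v w = c • sumTabloids k (a + b) v) ∧
  (∃ v < b, ∃ c : k, c ≠ 0 ∧ psi k (a + b) b v w = c • sumTabloids k (a + b) v) ∧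
  ¬ ∃ c : k, ∀ v < b, psi k (a + b) b v (c • sumTabloids k (a + b) b - w) = 0

open Classical in
/-- The sum of all tabloids of shape `(n - b, b)` whose first row contains the labels `1, …, m`. -/
def sumTabloidsTop (k : Type u) [Field k] (n b m : ℕ) : PermModule k n b :=
  ∑ X : Tabloid n b with ∀ i : Fin n, (i : ℕ) < m → i ∉ X, Finsupp.single X 1

/-- `E` is a non-split extension of `S` by the trivial module `k`: there is a short exact sequence
`0 → S → E → k → 0` of representations, with the inclusion as its first map, that has no
equivariant section. -/
def IsNonsplitExtensionByTrivial {k G V : Type*} [Field k] [Group G] [AddCommGroup V] [Module k V]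
    {ρ : Representation k G V} (S E : Subrepresentation ρ) : Prop :=
  S ≤ E ∧ ∃ q : E.toRepresentation.IntertwiningMap (Representation.trivial k G k),
    Function.Surjective q ∧ (∀ x : E.toSubmodule, q x = 0 ↔ (x : V) ∈ S) ∧
    ¬ ∃ s : (Representation.trivial k G k).IntertwiningMap E.toRepresentation,
      ∀ c : k, q (s c) = c

end TwoPartSpecht

end

/-! Identify a tabloid with its second row, a `b`-subset of the entries. Everything is read off from
the avoidance sums of an element of `M^(a,b)`: for a set `Z` of entries, the total coefficient of
the `b`-subsets disjoint from `Z`.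

The Specht module consists of the elements whose avoidance sums vanish for all `|Z| < b`
(`mem_specht_iff`). Polytabloids are products of `b` differences over disjoint pairs, and a set with
fewer than `b` elements misses some pair, whose factor then contributes zero; the converse is
`mem_pairSpan`. By inclusion-exclusion the same vanishing describes the common kernel of the
`ψ_{1,v}` with `v < b` (`mem_specht_iff_psi`).

The second rows occurring in `u` are the `b`-subsets of a set `T` with `2b - 1` elements, so the
avoidance sums of `u` are `C(|T \ Z|, b)` with `b ≤ |T \ Z| < 2b`. As `b` is a power of `p`, they
all equal `1` in `k` (`coeffSum_hemmer`). Constancy makes `u` invariant modulo the Specht module.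

The hypothesis on the valuation says `b ∤ a + 1`. Then `C(n - z, b)` is not a non-zero constant of
`k` for `z < b`, so no `c f - u` lies in the Specht module (`smul_sumTabloids_sub_hemmer_notMem`).
Since the invariants of `M^(a,b)` are the multiples of `f`, the coset of `u` has no invariant
element. This gives both the non-split extension and the cocycle `σ ↦ σu - u` that is not a
coboundary. -/

noncomputable section

namespace TwoPartSpecht


/-! ### Products of differences and the kernel intersection theorem for subsets -/

section Pairs

variable {k ι : Type*} [Field k] [DecidableEq ι]

/-- Multiplication by the variable `i` on formal sums of square-free monomials. -/
def insertMap (k : Type*) [Field k] (i : ι) : (Finset ι →₀ k) →ₗ[k] (Finset ι →₀ k) :=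
  Finsupp.lmapDomain k k (insert i)

@[simp]
theorem insertMap_single (i : ι) (X : Finset ι) (c : k) :
    insertMap k i (Finsupp.single X c) = Finsupp.single (insert i X) c := by
  simp [insertMap]

/-- The product of the differences `c - d` over a list of pairs `(c, d)`. -/
def pairProduct (k : Type*) [Field k] : List (ι × ι) → (Finset ι →₀ k)
  | [] => Finsupp.single ∅ 1
  | p :: L => insertMap k p.1 (pairProduct k L) - insertMap k p.2 (pairProduct k L)

/-- The sum of the coefficients at the sets which contain `Y` and avoid `Z`. -/
def coeffSum (k : Type*) [Field k] (Y Z : Finset ι) : (Finset ι →₀ k) →ₗ[k] k :=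
  Finsupp.linearCombination k fun X => if Y ⊆ X ∧ Disjoint X Z then 1 else 0

@[simp]
theorem coeffSum_single (Y Z X : Finset ι) (c : k) :
    coeffSum k Y Z (Finsupp.single X c) = if Y ⊆ X ∧ Disjoint X Z then c else 0 := by
  simp [coeffSum]

/-- One step of inclusion-exclusion, trading a required element for a forbidden one. It carries all
passages between avoidance sums and the maps `ψ_{1,v}`. -/
theorem coeffSum_insert_left (Y Z : Finset ι) (i : ι) (f : Finset ι →₀ k) :
    coeffSum k (insert i Y) Z f = coeffSum k Y Z f - coeffSum k Y (insert i Z) f := by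
  induction f using Finsupp.induction_linear with
  | zero => simp
  | add f g hf hg => simp only [map_add, hf, hg]; ring
  | single X c =>
    simp only [coeffSum_single, Finset.insert_subset_iff, Finset.disjoint_insert_right]
    by_cases h1 : i ∈ X <;> by_cases h2 : Y ⊆ X <;> by_cases h3 : Disjoint X Z <;>
      simp [h1, h2, h3]

theorem coeffSum_eq_zero_of_avoid {b : ℕ} {f : Finset ι →₀ k}
    (hf : ∀ Z : Finset ι, Z.card < b → coeffSum k ∅ Z f = 0) (Y Z : Finset ι)
    (h : Y.card + Z.card < b) : coeffSum k Y Z f = 0 := by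
  induction Y using Finset.induction_on generalizing Z with
  | empty => exact hf Z (by simpa using h)
  | insert i Y hi ih =>
    rw [Finset.card_insert_of_notMem hi] at h
    have := Finset.card_insert_le i Z
    rw [coeffSum_insert_left, ih Z (by omega), ih (insert i Z) (by omega), sub_zero]

/-- For `i` outside `Z` the result does not depend on `i`; this is why a difference over a pair
missed by `Z` contributes zero. -/
theorem coeffSum_insertMap (Z : Finset ι) (i : ι) (f : Finset ι →₀ k) :
    coeffSum k ∅ Z (insertMap k i f) = if i ∈ Z then 0 else coeffSum k ∅ Z f := by
  induction f using Finsupp.induction_linear with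
  | zero => simp
  | add f g hf hg => simp only [map_add, hf, hg]; split_ifs <;> simp
  | single X c =>
    by_cases h1 : i ∈ Z <;> simp [h1]

/-- The entries of a list of pairs. -/
def pairEntries (L : List (ι × ι)) : List ι := L.map Prod.fst ++ L.map Prod.snd

theorem nodup_pairEntries_cons {ι : Type*} {p : ι × ι} {L : List (ι × ι)} :
    (pairEntries (p :: L)).Nodup ↔
      p.1 ≠ p.2 ∧ p.1 ∉ pairEntries L ∧ p.2 ∉ pairEntries L ∧ (pairEntries L).Nodup := by
  simp only [pairEntries, List.map_cons, List.cons_append, List.nodup_cons,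
    List.nodup_append, List.mem_append, List.mem_cons]
  grind

theorem mem_pairEntries_cons {ι : Type*} {p : ι × ι} {L : List (ι × ι)} {i : ι} :
    i ∈ pairEntries (p :: L) ↔ i = p.1 ∨ i = p.2 ∨ i ∈ pairEntries L := by
  simp only [pairEntries, List.map_cons, List.mem_append, List.mem_cons]
  tauto

theorem length_le_card_of_meets (L : List (ι × ι)) (hL : (pairEntries L).Nodup) (Z : Finset ι)
    (hZ : ∀ p ∈ L, p.1 ∈ Z ∨ p.2 ∈ Z) : L.length ≤ Z.card := by
  induction L generalizing Z with
  | nil => simp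
  | cons p L ih =>
    obtain ⟨-, h1, h2, h3⟩ := nodup_pairEntries_cons.1 hL
    -- An element of `Z` outside the remaining pairs can be erased without affecting how `Z` meets
    -- them.
    have key : ∀ z ∈ Z, z ∉ pairEntries L → L.length + 1 ≤ Z.card := by
      intro z hz hzL
      have := ih h3 (Z.erase z) fun q hq => by
        have hq1 : q.1 ≠ z := fun h => hzL (by
          rw [← h]; exact List.mem_append_left _ (List.mem_map_of_mem hq))
        have hq2 : q.2 ≠ z := fun h => hzL (by
          rw [← h]; exact List.mem_append_right _ (List.mem_map_of_mem hq))
        simpa [hq1, hq2] using hZ q (List.mem_cons_of_mem _ hq)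
      rw [Finset.card_erase_of_mem hz] at this
      have := Finset.card_pos.2 ⟨z, hz⟩
      omega
    rcases hZ p List.mem_cons_self with h | h
    · exact key _ h h1
    · exact key _ h h2

theorem coeffSum_pairProduct_of_mem (L : List (ι × ι)) (Z : Finset ι)
    (hZ : ∃ p ∈ L, p.1 ∉ Z ∧ p.2 ∉ Z) : coeffSum k ∅ Z (pairProduct k L) = 0 := by
  induction L with
  | nil => simp at hZ
  | cons p L ih =>
    rw [pairProduct, map_sub, coeffSum_insertMap, coeffSum_insertMap]
    obtain ⟨q, hq, h1, h2⟩ := hZ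
    rcases List.mem_cons.1 hq with rfl | hq
    · simp [h1, h2]
    · simp [ih ⟨q, hq, h1, h2⟩]

theorem coeffSum_pairProduct (L : List (ι × ι)) (hL : (pairEntries L).Nodup) (Z : Finset ι)
    (hZ : Z.card < L.length) : coeffSum k ∅ Z (pairProduct k L) = 0 := by
  apply coeffSum_pairProduct_of_mem
  by_contra! h
  have := length_le_card_of_meets L hL Z fun p hp => by
    have := h p hp
    tauto
  omega

/-- The formal sums of `b`-element subsets of `A`. -/
def subsetSpan (k : Type*) {ι : Type*} [Field k] (A : Finset ι) (b : ℕ) :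
    Submodule k (Finset ι →₀ k) :=
  Finsupp.supported k k {X | X ⊆ A ∧ X.card = b}

theorem subsetSpan_mono {k ι : Type*} [Field k] {A B : Finset ι} (h : A ⊆ B) (b : ℕ) :
    subsetSpan k A b ≤ subsetSpan k B b :=
  Finsupp.supported_mono fun _ hX => ⟨hX.1.trans h, hX.2⟩

theorem insertMap_mem_subsetSpan {A : Finset ι} {b : ℕ} {i : ι} (hi : i ∉ A)
    {f : Finset ι →₀ k} (hf : f ∈ subsetSpan k A b) :
    insertMap k i f ∈ subsetSpan k (insert i A) (b + 1) := by
  refine Finsupp.supported_comap_lmapDomain k k (insert i) _ (Finsupp.supported_mono ?_ hf)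
  rintro X ⟨hX, rfl⟩
  exact ⟨Finset.insert_subset_insert i hX, Finset.card_insert_of_notMem fun h => hi (hX h)⟩

theorem pairProduct_mem_subsetSpan (L : List (ι × ι)) (hL : (pairEntries L).Nodup) :
    pairProduct k L ∈ subsetSpan k (pairEntries L).toFinset L.length := by
  induction L with
  | nil => exact Finsupp.single_mem_supported k 1 (by simp)
  | cons p L ih =>
    obtain ⟨h, h1, h2, h3⟩ := nodup_pairEntries_cons.1 hL
    refine sub_mem (subsetSpan_mono ?_ _ (insertMap_mem_subsetSpan ?_ (ih h3)))
      (subsetSpan_mono ?_ _ (insertMap_mem_subsetSpan ?_ (ih h3)))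
    · intro i; simp [mem_pairEntries_cons]; tauto
    · simpa using h1
    · intro i; simp [mem_pairEntries_cons]; tauto
    · simpa using h2

/-- The span of the products of the differences over `b` disjoint pairs of elements of `A`. -/
def pairSpan (k : Type*) [Field k] (A : Finset ι) (b : ℕ) : Submodule k (Finset ι →₀ k) :=
  Submodule.span k
    (pairProduct k '' {L | L.length = b ∧ (pairEntries L).Nodup ∧ ∀ i ∈ pairEntries L, i ∈ A})

theorem pairSpan_mono {A B : Finset ι} (h : A ⊆ B) (b : ℕ) : pairSpan k A b ≤ pairSpan k B b :=
  Submodule.span_mono (Set.image_mono fun _ hL => ⟨hL.1, hL.2.1, fun i hi => h (hL.2.2 i hi)⟩)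

theorem coeffSum_pairSpan {A : Finset ι} {b : ℕ} {f : Finset ι →₀ k} (hf : f ∈ pairSpan k A b)
    (Z : Finset ι) (hZ : Z.card < b) : coeffSum k ∅ Z f = 0 := by
  suffices pairSpan k A b ≤ LinearMap.ker (coeffSum k ∅ Z) from this hf
  refine Submodule.span_le.2 ?_
  rintro _ ⟨L, ⟨rfl, h, -⟩, rfl⟩
  exact coeffSum_pairProduct L h Z hZ

/-- Multiplying by a further difference lifts elements of `pairSpan`. -/
theorem exists_insertMap_sub_mem_pairSpan {A : Finset ι} {b : ℕ} {n : ι} (hn : n ∉ A)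
    (hA : 2 * b < A.card) {g : Finset ι →₀ k} (hg : g ∈ pairSpan k A b) :
    ∃ e ∈ pairSpan k (insert n A) (b + 1), insertMap k n g - e ∈ subsetSpan k A (b + 1) := by
  induction hg using Submodule.span_induction with
  | zero => exact ⟨0, zero_mem _, by simp⟩
  | add x y _ _ hx hy =>
    obtain ⟨e, he, hxe⟩ := hx
    obtain ⟨e', he', hye⟩ := hy
    refine ⟨e + e', add_mem he he', ?_⟩
    rw [map_add, add_sub_add_comm]
    exact add_mem hxe hye
  | smul c x _ hx =>
    obtain ⟨e, he, hxe⟩ := hx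
    refine ⟨c • e, Submodule.smul_mem _ c he, ?_⟩
    rw [map_smul, ← smul_sub]
    exact Submodule.smul_mem _ c hxe
  | mem x hx =>
    obtain ⟨L, ⟨rfl, h, hLA⟩, rfl⟩ := hx
    have hlen : (pairEntries L).toFinset.card < A.card := by
      refine (List.toFinset_card_le _).trans_lt ?_
      simp only [pairEntries, List.length_append, List.length_map]
      omega
    -- The list uses at most `2b < |A|` entries, so some `r` in `A` is free to be paired with `n`;
    -- the error term is then the product times `r`, which does not involve `n`.
    obtain ⟨r, hrA, hr⟩ := Finset.exists_mem_notMem_of_card_lt_card hlen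
    rw [List.mem_toFinset] at hr
    refine ⟨pairProduct k ((n, r) :: L), Submodule.subset_span ⟨_, ⟨rfl, ?_, ?_⟩, rfl⟩, ?_⟩
    · exact nodup_pairEntries_cons.2 ⟨fun h : n = r => hn (h ▸ hrA), fun h => hn (hLA n h), hr, h⟩
    · intro i hi
      rcases mem_pairEntries_cons.1 hi with rfl | rfl | hi
      · simp
      · exact Finset.mem_insert_of_mem hrA
      · exact Finset.mem_insert_of_mem (hLA i hi)
    · rw [pairProduct, sub_sub_cancel]
      refine subsetSpan_mono ?_ _
        (insertMap_mem_subsetSpan (by simpa using hr) (pairProduct_mem_subsetSpan L h))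
      intro i hi
      rcases Finset.mem_insert.1 hi with rfl | hi
      · exact hrA
      · exact hLA i (by simpa using hi)

theorem exists_eq_insertMap_add {A : Finset ι} {n : ι} {b : ℕ}
    {f : Finset ι →₀ k} (hf : f ∈ subsetSpan k (insert n A) (b + 1)) :
    ∃ g ∈ subsetSpan k A b, ∃ h ∈ subsetSpan k A (b + 1), f = insertMap k n g + h := by
  rw [subsetSpan, Finsupp.supported_eq_span_single] at hf
  induction hf using Submodule.span_induction with
  | zero => exact ⟨0, zero_mem _, 0, zero_mem _, by simp⟩
  | add x y _ _ hx hy =>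
    obtain ⟨g, hg, h, hh, rfl⟩ := hx
    obtain ⟨g', hg', h', hh', rfl⟩ := hy
    exact ⟨g + g', add_mem hg hg', h + h', add_mem hh hh', by rw [map_add]; abel⟩
  | smul c x _ hx =>
    obtain ⟨g, hg, h, hh, rfl⟩ := hx
    exact ⟨c • g, Submodule.smul_mem _ c hg, c • h, Submodule.smul_mem _ c hh, by simp⟩
  | mem x hx =>
    obtain ⟨X, ⟨hXA, hXb⟩, rfl⟩ := hx
    by_cases hnX : n ∈ X
    · refine ⟨Finsupp.single (X.erase n) 1, Finsupp.single_mem_supported k 1 ⟨?_, ?_⟩, 0,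
        zero_mem _, ?_⟩
      · rwa [← Finset.subset_insert_iff]
      · rw [Finset.card_erase_of_mem hnX, hXb, Nat.add_sub_cancel]
      · simp [Finset.insert_erase hnX]
    · refine ⟨0, zero_mem _, Finsupp.single X 1, Finsupp.single_mem_supported k 1 ⟨?_, hXb⟩,
        by simp⟩
      rwa [Finset.subset_insert_iff_of_notMem hnX] at hXA

theorem coeffSum_insert_right_of_mem_subsetSpan {A : Finset ι} {b : ℕ} {f : Finset ι →₀ k}
    (hf : f ∈ subsetSpan k A b) {n : ι} (hn : n ∉ A) (Z : Finset ι) :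
    coeffSum k ∅ (insert n Z) f = coeffSum k ∅ Z f := by
  rw [← sub_eq_zero, ← LinearMap.sub_apply]
  suffices subsetSpan k A b ≤ LinearMap.ker (coeffSum k ∅ (insert n Z) - coeffSum k ∅ Z) from
    this hf
  rw [subsetSpan, Finsupp.supported_eq_span_single, Submodule.span_le]
  rintro _ ⟨X, ⟨hX, -⟩, rfl⟩
  have : n ∉ X := fun h => hn (hX h)
  simp [this]

/-- A `b`-subset of `A` avoiding `A \ X` lies in `X`, hence equals `X`: single coefficients are
avoidance sums. -/
theorem coeffSum_sdiff {A : Finset ι} {b : ℕ} {f : Finset ι →₀ k}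
    (hf : f ∈ subsetSpan k A b) {X : Finset ι} (hX : X.card = b) :
    coeffSum k ∅ (A \ X) f = f X := by
  rw [← sub_eq_zero]
  suffices subsetSpan k A b ≤ LinearMap.ker (coeffSum k ∅ (A \ X) - Finsupp.lapply X) from
    this hf
  rw [subsetSpan, Finsupp.supported_eq_span_single, Submodule.span_le]
  rintro _ ⟨W, ⟨hW, hWb⟩, rfl⟩
  have : Disjoint W (A \ X) ↔ W = X := by
    constructor
    · intro h
      refine Finset.eq_of_subset_of_card_le (fun i hi => ?_) (by omega)
      by_contra hiX
      exact Finset.disjoint_left.1 h hi (Finset.mem_sdiff.2 ⟨hW hi, hiX⟩)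
    · rintro rfl
      exact Finset.disjoint_sdiff
  simp [this, Finsupp.single_apply]

/-- Here the complement in `A` of a `b`-subset has fewer than `b` elements, so every coefficient is
one of the vanishing sums. -/
theorem eq_zero_of_card_lt {A : Finset ι} {b : ℕ} (hA : A.card < 2 * b) {f : Finset ι →₀ k}
    (hf : f ∈ subsetSpan k A b) (h : ∀ Z : Finset ι, Z.card < b → coeffSum k ∅ Z f = 0) :
    f = 0 := by
  ext X
  by_cases hX : X ⊆ A ∧ X.card = b
  · rw [← coeffSum_sdiff hf hX.2]
    apply h
    rw [Finset.card_sdiff_of_subset hX.1]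
    omega
  · by_contra hne
    exact hX (hf (Finsupp.mem_support_iff.2 hne))

theorem subsetSpan_zero_le_pairSpan (A : Finset ι) : subsetSpan k A 0 ≤ pairSpan k A 0 := by
  rw [subsetSpan, Finsupp.supported_eq_span_single]
  refine Submodule.span_mono ?_
  rintro _ ⟨X, ⟨-, hX⟩, rfl⟩
  refine ⟨[], ⟨rfl, List.nodup_nil, fun i hi => by simp [pairEntries] at hi⟩, ?_⟩
  rw [Finset.card_eq_zero.1 hX, pairProduct]

/-- The kernel intersection theorem for two rows: a formal sum of `b`-element subsets is a
combination of products of differences over `b` disjoint pairs if its sums over the subsets avoiding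
fewer than `b` elements vanish. -/
theorem mem_pairSpan (A : Finset ι) (b : ℕ) (f : Finset ι →₀ k) (hf : f ∈ subsetSpan k A b)
    (h : ∀ Z : Finset ι, Z.card < b → coeffSum k ∅ Z f = 0) : f ∈ pairSpan k A b := by
  induction A using Finset.induction_on generalizing b f with
  | empty =>
    obtain _ | b := b
    · exact subsetSpan_zero_le_pairSpan _ hf
    rw [eq_zero_of_card_lt (by simp) hf h]
    exact zero_mem _
  | insert n A hn ih =>
    obtain _ | b := b
    · exact subsetSpan_zero_le_pairSpan _ hf
    by_cases hA : A.card < 2 * b + 1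
    · rw [eq_zero_of_card_lt (by rw [Finset.card_insert_of_notMem hn]; omega) hf h]
      exact zero_mem _
    obtain ⟨g, hg, r, hr, rfl⟩ := exists_eq_insertMap_add hf
    -- Forbidding `n` as well isolates the sum of `r`, which therefore vanishes; allowing `n` then
    -- leaves the sum of `g`. The one extra forbidden element is affordable because the bound for
    -- `g` is `b` instead of `b + 1`.
    have hgp : g ∈ pairSpan k A b := ih b g hg fun Z hZ => by
      have hZn : coeffSum k ∅ Z g = coeffSum k ∅ (Z.erase n) g := by
        by_cases hnZ : n ∈ Z
        · rw [← coeffSum_insert_right_of_mem_subsetSpan hg hn (Z.erase n), Finset.insert_erase hnZ]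
        · rw [Finset.erase_eq_of_notMem hnZ]
      have hZ' := (Finset.card_erase_le (s := Z) (a := n)).trans_lt hZ
      have h1 := h (Z.erase n) (by omega)
      have h2 := h (insert n (Z.erase n))
        (by have := Finset.card_insert_le n (Z.erase n); omega)
      rw [map_add, coeffSum_insertMap] at h1 h2
      rw [coeffSum_insert_right_of_mem_subsetSpan hr hn, if_pos (Finset.mem_insert_self _ _),
        zero_add] at h2
      rw [h2, add_zero, if_neg (Finset.notMem_erase n Z)] at h1
      rw [hZn, h1]
    -- Subtracting `e` removes every set containing `n`, and the remainder falls under the induction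
    -- hypothesis for `A`.
    obtain ⟨e, he, hge⟩ := exists_insertMap_sub_mem_pairSpan hn (by omega) hgp
    have : insertMap k n g + r = e + (insertMap k n g - e + r) := by abel
    rw [this]
    refine add_mem he (pairSpan_mono (Finset.subset_insert _ _) _ (ih _ _ (add_mem hge hr) ?_))
    intro Z hZ
    have h1 := h Z hZ
    rw [this, map_add, coeffSum_pairSpan he Z hZ, zero_add] at h1
    exact h1

end Pairs


/-! ### Expansion of a product of differences -/

section Expansion

variable {k ι κ : Type*} [Field k] [DecidableEq ι] [DecidableEq κ]

/-- Multiplying out: `J` records the factors from which the second term, with its minus sign, is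
taken. -/
theorem pairProduct_map (c d : κ → ι) (l : List κ) (hl : l.Nodup) :
    pairProduct k (l.map fun j => (c j, d j)) = ∑ J ∈ l.toFinset.powerset,
      Finsupp.single (l.toFinset.image fun j => if j ∈ J then d j else c j) ((-1) ^ J.card) := by
  induction l with
  | nil => simp [pairProduct]
  | cons x l ih =>
    obtain ⟨hx, hl⟩ := List.nodup_cons.1 hl
    have hx' : x ∉ l.toFinset := by simpa using hx
    rw [List.map_cons, pairProduct, ih hl, List.toFinset_cons, Finset.sum_powerset_insert hx',
      map_sum, map_sum, sub_eq_add_neg, ← Finset.sum_neg_distrib]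
    congr 1
    · refine Finset.sum_congr rfl fun J hJ => ?_
      have hxJ : x ∉ J := fun h => hx' (Finset.mem_powerset.1 hJ h)
      rw [insertMap_single, Finset.image_insert, if_neg hxJ]
    · refine Finset.sum_congr rfl fun J hJ => ?_
      have hxJ : x ∉ J := fun h => hx' (Finset.mem_powerset.1 hJ h)
      rw [insertMap_single, Finset.image_insert, if_pos (Finset.mem_insert_self _ _),
        Finset.card_insert_of_notMem hxJ, pow_succ, mul_neg_one, Finsupp.single_neg]
      congr 3
      refine Finset.image_congr fun j hj => ?_
      have hjx : j ≠ x := by rintro rfl; exact hx' hj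
      simp [hjx]

end Expansion

/-! ### Column-preserving permutations of a two-row diagram -/

section ColumnStabilizer

variable {a b : ℕ}

/-- The involution of the cells which exchanges the two cells of each column in `J`. -/
def flipCells (hab : b ≤ a) (J : Finset (Fin b)) : Equiv.Perm (Fin a ⊕ Fin b) :=
  Function.Involutive.toPerm
    (Sum.elim
      -- The chosen column is unique, since `Fin.castLE` is injective.
      (fun i => if h : ∃ j ∈ J, Fin.castLE hab j = i then Sum.inr h.choose else Sum.inl i)
      (fun j => if j ∈ J then Sum.inl (Fin.castLE hab j) else Sum.inr j))
    (by
      rintro (i | j)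
      · by_cases h : ∃ j ∈ J, Fin.castLE hab j = i
        · have := h.choose_spec
          simp only [Sum.elim_inl, dif_pos h, Sum.elim_inr, if_pos this.1, this.2]
        · simp only [Sum.elim_inl, dif_neg h]
      · by_cases hj : j ∈ J
        · have h : ∃ j' ∈ J, Fin.castLE hab j' = Fin.castLE hab j := ⟨j, hj, rfl⟩
          have := Fin.castLE_injective hab h.choose_spec.2
          simp only [Sum.elim_inr, if_pos hj, Sum.elim_inl, dif_pos h, this]
        · simp only [Sum.elim_inr, if_neg hj])

theorem flipCells_inr (hab : b ≤ a) (J : Finset (Fin b)) (j : Fin b) :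
    flipCells hab J (Sum.inr j) = if j ∈ J then Sum.inl (Fin.castLE hab j) else Sum.inr j := rfl

theorem flipCells_castLE (hab : b ≤ a) (J : Finset (Fin b)) (j : Fin b) :
    flipCells hab J (Sum.inl (Fin.castLE hab j)) =
      if j ∈ J then Sum.inr j else Sum.inl (Fin.castLE hab j) := by
  change (if h : ∃ j' ∈ J, Fin.castLE hab j' = Fin.castLE hab j then Sum.inr h.choose
    else Sum.inl (Fin.castLE hab j)) = _
  by_cases hj : j ∈ J
  · have h : ∃ j' ∈ J, Fin.castLE hab j' = Fin.castLE hab j := ⟨j, hj, rfl⟩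
    rw [dif_pos h, if_pos hj, Fin.castLE_injective hab h.choose_spec.2]
  · rw [if_neg hj, dif_neg]
    rintro ⟨j', hj', h⟩
    exact hj (Fin.castLE_injective hab h ▸ hj')

theorem flipCells_inl_of_le (hab : b ≤ a) (J : Finset (Fin b)) {i : Fin a} (hi : b ≤ i) :
    flipCells hab J (Sum.inl i) = Sum.inl i := by
  refine dif_neg ?_
  rintro ⟨j, -, rfl⟩
  exact absurd hi (by simp)

theorem eq_castLE_or_le (hab : b ≤ a) (i : Fin a) : (∃ j, i = Fin.castLE hab j) ∨ b ≤ i := by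
  by_cases h : (i : ℕ) < b
  · exact Or.inl ⟨⟨i, h⟩, rfl⟩
  · exact Or.inr (by omega)

theorem column_flipCells (hab : b ≤ a) (J : Finset (Fin b)) (x : Fin a ⊕ Fin b) :
    column (flipCells hab J x) = column x := by
  rcases x with i | j
  · rcases eq_castLE_or_le hab i with ⟨j, rfl⟩ | hi
    · rw [flipCells_castLE]; split_ifs <;> simp [column]
    · rw [flipCells_inl_of_le hab J hi]
  · rw [flipCells_inr]; split_ifs <;> simp [column]

theorem flipCells_insert (hab : b ≤ a) {J : Finset (Fin b)} {j : Fin b} (hj : j ∉ J) :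
    flipCells hab (insert j J) =
      Equiv.swap (Sum.inl (Fin.castLE hab j)) (Sum.inr j) * flipCells hab J := by
  ext1 x
  rw [Equiv.Perm.mul_apply]
  rcases x with i | j'
  · rcases eq_castLE_or_le hab i with ⟨j', rfl⟩ | hi
    · rw [flipCells_castLE, flipCells_castLE]
      have := Fin.castLE_injective hab
      by_cases h : j' = j
      · subst h; simp [hj]
      · by_cases h' : j' ∈ J <;> simp [h, h', Equiv.swap_apply_def, this.eq_iff]
    · rw [flipCells_inl_of_le hab _ hi, flipCells_inl_of_le hab _ hi,
        Equiv.swap_apply_of_ne_of_ne _ Sum.inl_ne_inr]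
      intro h
      rw [Sum.inl.injEq] at h
      subst h
      exact absurd hi (by simp)
  · rw [flipCells_inr, flipCells_inr]
    have := Fin.castLE_injective hab
    by_cases h : j' = j
    · subst h; simp [hj]
    · by_cases h' : j' ∈ J <;> simp [h, h', Equiv.swap_apply_def, this.eq_iff]

theorem sign_flipCells (hab : b ≤ a) (J : Finset (Fin b)) :
    Equiv.Perm.sign (flipCells hab J) = (-1) ^ J.card := by
  induction J using Finset.induction_on with
  | empty =>
    have : flipCells hab ∅ = 1 := by
      ext1 x
      rcases x with i | j
      · rcases eq_castLE_or_le hab i with ⟨j, rfl⟩ | hi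
        · rw [flipCells_castLE]; simp
        · rw [flipCells_inl_of_le hab _ hi]; rfl
      · rw [flipCells_inr]; simp
    rw [this]; simp
  | insert j J hj ih =>
    rw [flipCells_insert hab hj, map_mul, ih, Equiv.Perm.sign_swap Sum.inl_ne_inr,
      Finset.card_insert_of_notMem hj, pow_succ, mul_comm]

theorem column_eq_iff_inr (hab : b ≤ a) (x : Fin a ⊕ Fin b) (j : Fin b) :
    column x = j ↔ x = Sum.inl (Fin.castLE hab j) ∨ x = Sum.inr j := by
  rcases x with i | j' <;> simp [column, Fin.ext_iff]

/-- A permutation of the cells which preserves the columns flips a set of columns. -/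
theorem exists_eq_flipCells (hab : b ≤ a) (τ : Equiv.Perm (Fin a ⊕ Fin b))
    (hτ : ∀ x, column (τ x) = column x) : ∃ J, τ = flipCells hab J := by
  refine ⟨Finset.univ.filter fun j => τ (Sum.inr j) = Sum.inl (Fin.castLE hab j), ?_⟩
  ext1 x
  rcases x with i | j
  · rcases eq_castLE_or_le hab i with ⟨j, rfl⟩ | hi
    · have h1 := (column_eq_iff_inr hab _ j).1 (hτ (Sum.inl (Fin.castLE hab j)))
      have h2 := (column_eq_iff_inr hab _ j).1 (hτ (Sum.inr j))
      have h3 : τ (Sum.inl (Fin.castLE hab j)) ≠ τ (Sum.inr j) :=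
        fun h => Sum.inl_ne_inr (τ.injective h)
      rw [flipCells_castLE]
      simp only [Finset.mem_filter_univ]
      rcases h1 with h1 | h1 <;> rcases h2 with h2 | h2 <;> simp_all
    · rw [flipCells_inl_of_le hab _ hi]
      have := hτ (Sum.inl i)
      rcases h : τ (Sum.inl i) with i' | j'
      · rw [h] at this
        congr 1
        exact Fin.ext this
      · rw [h] at this
        change (j' : ℕ) = i at this
        omega
  · rw [flipCells_inr]
    simp only [Finset.mem_filter_univ]
    rcases (column_eq_iff_inr hab _ j).1 (hτ (Sum.inr j)) with h | h <;> simp [h]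

theorem flipCells_injective (hab : b ≤ a) : Function.Injective (flipCells hab) := by
  intro J J' h
  ext j
  have := congrArg (fun τ => τ (Sum.inr j)) h
  simp only [flipCells_inr] at this
  by_cases h1 : j ∈ J <;> by_cases h2 : j ∈ J' <;> simp_all

end ColumnStabilizer

/-! ### Polytabloids as products of differences, and the Specht module as a kernel -/

section Polytabloid

variable (k : Type*) [Field k] {n a b : ℕ}

/-- The embedding of `M^(n - b, b)` into the formal sums of subsets. -/
def toSubsets (n b : ℕ) : PermModule k n b →ₗ[k] (Finset (Fin n) →₀ k) :=
  Finsupp.lmapDomain k k Subtype.val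

@[simp]
theorem toSubsets_single (X : Tabloid n b) (c : k) :
    toSubsets k n b (Finsupp.single X c) = Finsupp.single X.val c := by
  simp [toSubsets]

theorem toSubsets_injective (n b : ℕ) : Function.Injective (toSubsets k n b) :=
  Finsupp.mapDomain_injective Subtype.val_injective

theorem toSubsets_mem_subsetSpan (f : PermModule k n b) :
    toSubsets k n b f ∈ subsetSpan k Finset.univ b := by
  induction f using Finsupp.induction_linear with
  | zero => simp
  | add f g hf hg => rw [map_add]; exact add_mem hf hg
  | single X c =>
    rw [toSubsets_single]
    exact Finsupp.single_mem_supported k c ⟨Finset.subset_univ _, X.2⟩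

/-- The pairs of entries in the columns of length two of a tableau, the lower entry first. -/
def Tableau.columnPairs (hab : b ≤ a) (t : Tableau a b) : List (Fin (a + b) × Fin (a + b)) :=
  (List.finRange b).map fun j => (t.symm (Sum.inr j), t.symm (Sum.inl (Fin.castLE hab j)))

/-- The column stabilizer consists of the flips of sets `J` of columns of length two, with sign
`(-1)^|J|`; these match the terms of the expanded product. -/
theorem toSubsets_polytabloid (hab : b ≤ a) (t : Tableau a b) :
    toSubsets k (a + b) b (t.polytabloid k) = pairProduct k (t.columnPairs hab) := by
  classical
  rw [Tableau.columnPairs, pairProduct_map _ _ _ (List.nodup_finRange b), List.toFinset_finRange,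
    Finset.powerset_univ, Tableau.polytabloid, map_sum]
  symm
  refine Finset.sum_bij (fun J _ => t.symm.permCongr (flipCells hab J)) ?_ ?_ ?_ ?_
  · intro J _
    refine Finset.mem_filter.2 ⟨Finset.mem_univ _, fun x => ?_⟩
    simp [Equiv.permCongr_apply, column_flipCells]
  · intro J _ J' _ h
    exact flipCells_injective hab (t.symm.permCongr.injective h)
  · intro π hπ
    have hπ' : ∀ x, column (t (π x)) = column (t x) := (Finset.mem_filter.1 hπ).2
    obtain ⟨J, hJ⟩ := exists_eq_flipCells hab (t.permCongr π) fun x => by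
      simpa [Equiv.permCongr_apply] using hπ' (t.symm x)
    exact ⟨J, Finset.mem_univ _, by rw [← hJ]; ext x; simp [Equiv.permCongr_apply]⟩
  · intro J _
    rw [toSubsets_single, Equiv.Perm.sign_permCongr, sign_flipCells]
    congr 1
    · simp only [Set.powersetCard.coe_smul, Tableau.tabloid, Finset.smul_finset_def,
        Finset.map_eq_image, Finset.image_image]
      refine Finset.image_congr fun j _ => ?_
      simp [Equiv.permCongr_apply, flipCells_inr]
      split_ifs <;> rfl
    · simp

theorem exists_tableau_columnPairs (hab : b ≤ a) (L : List (Fin (a + b) × Fin (a + b)))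
    (hb : L.length = b) (hL : (pairEntries L).Nodup) :
    ∃ t : Tableau a b, t.columnPairs hab = L := by
  obtain ⟨h1, h2, h3⟩ := List.nodup_append.1 hL
  have hlt : ∀ j : Fin b, (j : ℕ) < L.length := fun j => j.2.trans_eq hb.symm
  let f : Fin a ⊕ Fin b → Fin (a + b) :=
    Sum.elim (fun i => if h : (i : ℕ) < b then (L[(i : ℕ)]'(h.trans_eq hb.symm)).2 else Fin.castAdd b i)
      (fun j => (L[(j : ℕ)]'(hlt j)).1)
  have hfl : ∀ i : Fin a, ∀ h : (i : ℕ) < b, f (Sum.inl i) = (L[(i : ℕ)]'(h.trans_eq hb.symm)).2 :=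
    fun i h => dif_pos h
  have hfr : ∀ j : Fin b, f (Sum.inr j) = (L[(j : ℕ)]'(hlt j)).1 := fun j => rfl
  have hinj : Set.InjOn f {x | column x < b} := by
    rintro (i | j) hx (i' | j') hy hxy
    · change (i : ℕ) < b at hx
      change (i' : ℕ) < b at hy
      rw [hfl i hx, hfl i' hy] at hxy
      congr 1
      refine Fin.ext ((List.Nodup.getElem_inj_iff h2 (i := i) (j := i') (hi := ?_)
        (hj := ?_)).1 ?_)
      · rw [List.length_map, hb]; exact hx
      · rw [List.length_map, hb]; exact hy
      · simpa using hxy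
    · change (i : ℕ) < b at hx
      rw [hfl i hx, hfr] at hxy
      exact absurd hxy.symm (h3 _ (List.mem_map_of_mem (List.getElem_mem _)) _
        (List.mem_map_of_mem (List.getElem_mem _)))
    · change (i' : ℕ) < b at hy
      rw [hfl i' hy, hfr] at hxy
      exact absurd hxy (h3 _ (List.mem_map_of_mem (List.getElem_mem _)) _
        (List.mem_map_of_mem (List.getElem_mem _)))
    · rw [hfr, hfr] at hxy
      congr 1
      refine Fin.ext ((List.Nodup.getElem_inj_iff h1 (i := j) (j := j') (hi := ?_)
        (hj := ?_)).1 ?_)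
      · rw [List.length_map, hb]; exact j.2
      · rw [List.length_map, hb]; exact j'.2
      · simpa using hxy
  obtain ⟨g, hg⟩ := Set.MapsTo.exists_equiv_extend_of_card_eq (t := Finset.univ) (by simp)
    (fun x _ => by simp) hinj
  let e : Fin a ⊕ Fin b ≃ Fin (a + b) := g.trans (Equiv.subtypeUnivEquiv Finset.mem_univ)
  refine ⟨e.symm, ?_⟩
  refine List.ext_getElem (by simp [Tableau.columnPairs, hb]) fun i hi hi' => ?_
  have hib : i < b := hb ▸ hi'
  have hl := hg (Sum.inl (Fin.castLE hab ⟨i, hib⟩)) hib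
  have hr := hg (Sum.inr ⟨i, hib⟩) hib
  rw [hfl _ hib] at hl
  rw [hfr] at hr
  simp only [Tableau.columnPairs, List.getElem_map, List.getElem_finRange]
  exact Prod.ext hr hl

theorem nodup_columnPairs (hab : b ≤ a) (t : Tableau a b) :
    (pairEntries (t.columnPairs hab)).Nodup := by
  rw [pairEntries, Tableau.columnPairs, List.map_map, List.map_map, List.nodup_append]
  refine ⟨(List.nodup_finRange b).map fun i j h => by simpa using h,
    (List.nodup_finRange b).map fun i j h => by simpa [Fin.ext_iff] using h, ?_⟩
  simp

/-- The Specht module is the span of the products of differences over disjoint pairs. -/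
theorem map_toSubsets_specht (hab : b ≤ a) :
    (specht k a b).toSubmodule.map (toSubsets k (a + b) b) = pairSpan k Finset.univ b := by
  rw [specht, Submodule.map_span, pairSpan, ← Set.range_comp]
  congr 1
  ext f
  constructor
  · rintro ⟨t, rfl⟩
    exact ⟨t.columnPairs hab, ⟨by simp [Tableau.columnPairs], nodup_columnPairs hab t, by simp⟩,
      (toSubsets_polytabloid k hab t).symm⟩
  · rintro ⟨L, ⟨hb, hL, -⟩, rfl⟩
    obtain ⟨t, rfl⟩ := exists_tableau_columnPairs hab L hb hL
    exact ⟨t, toSubsets_polytabloid k hab t⟩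

/-- The kernel intersection theorem: membership in the Specht module is detected by the sums of the
coefficients over the tabloids whose second row avoids fewer than `b` given entries. -/
theorem mem_specht_iff (hab : b ≤ a) (f : PermModule k (a + b) b) :
    f ∈ (specht k a b).toSubmodule ↔
      ∀ Z : Finset (Fin (a + b)), Z.card < b → coeffSum k ∅ Z (toSubsets k (a + b) b f) = 0 := by
  rw [← SetLike.mem_coe, ← (toSubsets_injective k (a + b) b).mem_set_image,
    ← Submodule.map_coe, SetLike.mem_coe, map_toSubsets_specht k hab]
  exact ⟨fun h => coeffSum_pairSpan h, mem_pairSpan _ _ _ (toSubsets_mem_subsetSpan k f)⟩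

open Classical in
theorem psi_apply (v : ℕ) (f : PermModule k n b) (Y : Tabloid n v) :
    psi k n b v f Y = coeffSum k Y.val ∅ (toSubsets k n b f) := by
  induction f using Finsupp.induction_linear with
  | zero => simp
  | add f g hf hg => simp [hf, hg]
  | single X c =>
    rw [toSubsets_single, coeffSum_single, psi, Finsupp.linearCombination_single,
      Finsupp.smul_apply, Finsupp.finsetSum_apply]
    simp [Finsupp.single_apply, Finset.sum_ite_eq']

theorem psi_eq_zero_of_mem_specht (hab : b ≤ a) {f : PermModule k (a + b) b}
    (hf : f ∈ (specht k a b).toSubmodule) {v : ℕ} (hv : v < b) : psi k (a + b) b v f = 0 := by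
  ext Y
  rw [psi_apply, Finsupp.zero_apply]
  refine coeffSum_eq_zero_of_avoid ((mem_specht_iff k hab f).1 hf) _ _ ?_
  rw [Y.2]
  simpa using hv

end Polytabloid


/-! ### Binomial coefficients modulo `p` -/

section Binomial

variable {k : Type*} [Field k] (p : ℕ) [CharP k p]

open Polynomial in
-- Compare coefficients in `(1 + X)^(p^β + m) = (1 + X^(p^β)) (1 + X)^m`.
theorem cast_choose_pow_add [Fact p.Prime] (β m j : ℕ) :
    ((p ^ β + m).choose j : k) =
      m.choose j + if p ^ β ≤ j then (m.choose (j - p ^ β) : k) else 0 := by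
  have h : (1 + X : k[X]) ^ (p ^ β + m) = (1 + X) ^ m + X ^ p ^ β * (1 + X) ^ m := by
    rw [pow_add, add_pow_char_pow]
    ring
  have := congrArg (fun f => coeff f j) h
  simpa only [coeff_add, coeff_one_add_X_pow, coeff_X_pow_mul'] using this

theorem cast_choose_pow_add_self [Fact p.Prime] (β : ℕ) {r : ℕ} (hr : r < p ^ β) :
    ((p ^ β + r).choose (p ^ β) : k) = 1 := by
  rw [cast_choose_pow_add p]
  simp [Nat.choose_eq_zero_of_lt hr]

theorem cast_choose_pow_mul_add [Fact p.Prime] (β q r : ℕ) {j : ℕ} (hj : j < p ^ β) :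
    ((p ^ β * q + r).choose j : k) = r.choose j := by
  induction q with
  | zero => simp
  | succ q ih =>
    rw [mul_add, mul_one, add_right_comm, add_comm, cast_choose_pow_add p, if_neg (by omega),
      add_zero, ih]

end Binomial

/-! ### The group action, invariants and avoidance sums of sums of tabloids -/

section Equivariance

variable {k : Type*} [Field k] {n b : ℕ}

theorem permRep_single (σ : Equiv.Perm (Fin n)) (X : Tabloid n b) (c : k) :
    permRep k n b σ (Finsupp.single X c) = Finsupp.single (σ • X) c := by
  simp [permRep]

theorem permRep_apply_smul (σ : Equiv.Perm (Fin n)) (f : PermModule k n b) (X : Tabloid n b) :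
    permRep k n b σ f (σ • X) = f X :=
  Finsupp.mapDomain_apply (MulAction.injective σ) f X

theorem coeffSum_permRep (σ : Equiv.Perm (Fin n)) (f : PermModule k n b) (Z : Finset (Fin n)) :
    coeffSum k ∅ Z (toSubsets k n b (permRep k n b σ f)) =
      coeffSum k ∅ (Z.map σ⁻¹.toEmbedding) (toSubsets k n b f) := by
  induction f using Finsupp.induction_linear with
  | zero => simp
  | add f g hf hg => simp only [map_add, hf, hg]
  | single X c =>
    have : Disjoint (σ • X).val Z ↔ Disjoint X.val (Z.map σ⁻¹.toEmbedding) := by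
      have hX : (σ • X).val = X.val.map σ.toEmbedding := by
        rw [Set.powersetCard.coe_smul, Finset.smul_finset_def, Finset.map_eq_image]
        rfl
      have hZ : Z = (Z.map σ⁻¹.toEmbedding).map σ.toEmbedding := by
        ext i
        simp [show Equiv.symm σ⁻¹ = σ from rfl]
      conv_lhs => rw [hX, hZ]
      exact Finset.disjoint_map _
    rw [permRep_single, toSubsets_single, toSubsets_single]
    simp only [coeffSum_single, Finset.empty_subset, this]

/-- The symmetric group is transitive on tabloids, so an invariant element has constant
coefficients. -/
theorem eq_smul_sumTabloids (w : PermModule k n b)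
    (hw : ∀ σ : Equiv.Perm (Fin n), permRep k n b σ w = w) : ∃ c : k, w = c • sumTabloids k n b := by
  rcases isEmpty_or_nonempty (Tabloid n b) with h | ⟨⟨X⟩⟩
  · exact ⟨0, Subsingleton.elim _ _⟩
  refine ⟨w X, ?_⟩
  have := Set.powersetCard.isPretransitive (α := Fin n) (n := b)
  ext Y
  obtain ⟨σ, rfl⟩ := MulAction.exists_smul_eq (Equiv.Perm (Fin n)) X Y
  have h1 : w (σ • X) = w X := by
    conv_lhs => rw [← hw σ]
    exact permRep_apply_smul σ w X
  rw [h1, sumTabloids, Finsupp.smul_apply, Finsupp.finsetSum_apply]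
  simp [Finsupp.single_apply]

theorem sumTabloids_eq_sumTabloidsTop : sumTabloids k n b = sumTabloidsTop k n b 0 := by
  simp [sumTabloids, sumTabloidsTop]

theorem sumTabloids_apply (X : Tabloid n b) : sumTabloids k n b X = 1 := by
  rw [sumTabloids, Finsupp.finsetSum_apply]
  simp [Finsupp.single_apply]

theorem coeffSum_sumTabloidsTop (m : ℕ) (Z : Finset (Fin n)) :
    coeffSum k ∅ Z (toSubsets k n b (sumTabloidsTop k n b m)) =
      (({i : Fin n | m ≤ i} : Finset (Fin n)) \ Z).card.choose b := by
  classical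
  rw [sumTabloidsTop, map_sum, map_sum]
  simp only [toSubsets_single, coeffSum_single]
  rw [Finset.sum_boole, ← Finset.card_powersetCard, Finset.filter_filter]
  congr 1
  refine Finset.card_bij (fun X _ => X.val) ?_ (fun X _ Y _ h => Subtype.ext h) ?_
  · intro X hX
    obtain ⟨-, hX, -, hXZ⟩ := Finset.mem_filter.1 hX
    refine Finset.mem_powersetCard.2 ⟨fun i hi => ?_, X.2⟩
    refine Finset.mem_sdiff.2 ⟨?_, Finset.disjoint_left.1 hXZ hi⟩
    rw [Finset.mem_filter_univ]
    by_contra him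
    exact hX i (by omega) hi
  · intro X hX
    obtain ⟨hX, hXb⟩ := Finset.mem_powersetCard.1 hX
    refine ⟨⟨X, hXb⟩, Finset.mem_filter.2 ⟨Finset.mem_univ _, fun i hi hiX => ?_,
      Finset.empty_subset _, ?_⟩, rfl⟩
    · have := Finset.mem_filter.1 (Finset.mem_sdiff.1 (hX hiX)).1
      omega
    · exact Finset.disjoint_left.2 fun i hi => (Finset.mem_sdiff.1 (hX hi)).2

theorem coeffSum_sumTabloids (Z : Finset (Fin n)) :
    coeffSum k ∅ Z (toSubsets k n b (sumTabloids k n b)) = (n - Z.card).choose b := by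
  rw [sumTabloids_eq_sumTabloidsTop, coeffSum_sumTabloidsTop,
    Finset.card_sdiff_of_subset (by intro i _; simp)]
  simp

end Equivariance

/-! ### The Hemmer element -/

section Hemmer

variable {k : Type*} [Field k] {a b : ℕ}

/-- The maps `ψ_{1,v}` give the sums over sets containing `Y`; inclusion-exclusion converts these to
avoidance sums and back while `|Y| + |Z|` stays below `b`. -/
theorem mem_specht_iff_psi (hab : b ≤ a) (f : PermModule k (a + b) b) :
    f ∈ (specht k a b).toSubmodule ↔ ∀ v < b, psi k (a + b) b v f = 0 := by
  refine ⟨fun hf v hv => psi_eq_zero_of_mem_specht k hab hf hv, fun h => ?_⟩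
  rw [mem_specht_iff k hab]
  suffices ∀ Z Y : Finset (Fin (a + b)), Y.card + Z.card < b →
      coeffSum k Y Z (toSubsets k (a + b) b f) = 0 from
    fun Z hZ => this Z ∅ (by simpa using hZ)
  intro Z
  induction Z using Finset.induction_on with
  | empty =>
    intro Y hY
    have := psi_apply k Y.card f ⟨Y, rfl⟩
    rw [h _ (by simpa using hY)] at this
    exact this.symm
  | insert i Z hi ih =>
    intro Y hY
    rw [Finset.card_insert_of_notMem hi] at hY
    have := Finset.card_insert_le i Y
    have h1 := coeffSum_insert_left (k := k) Y Z i (toSubsets k (a + b) b f)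
    rw [ih (insert i Y) (by omega), ih Y (by omega), zero_sub] at h1
    exact neg_eq_zero.1 h1.symm

/-- The sums of the coefficients of the Hemmer element over the tabloids which avoid fewer than `b`
entries in their second row are all `1`. -/
theorem coeffSum_hemmer (p : ℕ) [CharP k p] [Fact p.Prime] {β : ℕ} (hab : b ≤ a) (hb : b = p ^ β)
    (Z : Finset (Fin (a + b))) (hZ : Z.card < b) :
    coeffSum k ∅ Z (toSubsets k (a + b) b (sumTabloidsTop k (a + b) b (a - b + 1))) = 1 := by
  rw [coeffSum_sumTabloidsTop]
  set T : Finset (Fin (a + b)) := {i : Fin (a + b) | a - b + 1 ≤ i} with hT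
  have hTc : T.card = 2 * b - 1 := by
    have : T.card = (Finset.Ico (a - b + 1) (a + b)).card := by
      rw [← Finset.card_map Fin.valEmbedding]
      congr 1
      ext i
      simp only [hT, Finset.mem_map, Finset.mem_filter_univ, Fin.valEmbedding_apply,
        Finset.mem_Ico]
      constructor
      · rintro ⟨j, hj, rfl⟩
        exact ⟨hj, j.2⟩
      · exact fun hi => ⟨⟨i, hi.2⟩, hi.1, rfl⟩
    rw [this, Nat.card_Ico]
    omega
  have h1 := Finset.card_sdiff_add_card_inter T Z
  have h2 := Finset.card_le_card (Finset.inter_subset_right (s₁ := T) (s₂ := Z))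
  -- At most `b - 1` of the `2b - 1` elements are removed, so `0 ≤ r < b`.
  obtain ⟨r, hr⟩ : ∃ r, (T \ Z).card = b + r := ⟨(T \ Z).card - b, by omega⟩
  rw [hr, hb]
  exact cast_choose_pow_add_self p β (by omega)

/-- Requiring an element takes a difference of two avoidance sums; these are constant, so any
non-empty requirement gives zero. -/
theorem coeffSum_hemmer_contains (p : ℕ) [CharP k p] [Fact p.Prime] {β : ℕ} (hab : b ≤ a)
    (hb : b = p ^ β) (Y : Finset (Fin (a + b))) (hY : Y.card < b) :
    coeffSum k Y ∅ (toSubsets k (a + b) b (sumTabloidsTop k (a + b) b (a - b + 1))) =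
      if Y = ∅ then 1 else 0 := by
  suffices ∀ Z : Finset (Fin (a + b)), Y.card + Z.card < b →
      coeffSum k Y Z (toSubsets k (a + b) b (sumTabloidsTop k (a + b) b (a - b + 1))) =
        if Y = ∅ then 1 else 0 from this ∅ (by simpa using hY)
  clear hY
  induction Y using Finset.induction_on with
  | empty => exact fun Z hZ => by simpa using coeffSum_hemmer p hab hb Z (by simpa using hZ)
  | insert i Y hi ih =>
    intro Z hZ
    rw [Finset.card_insert_of_notMem hi] at hZ
    have := Finset.card_insert_le i Z
    rw [coeffSum_insert_left, ih Z (by omega), ih (insert i Z) (by omega), sub_self,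
      if_neg (Finset.insert_ne_empty _ _)]

theorem psi_hemmer (p : ℕ) [CharP k p] [Fact p.Prime] {β : ℕ} (hab : b ≤ a) (hb : b = p ^ β)
    {v : ℕ} (hv : v < b) :
    psi k (a + b) b v (sumTabloidsTop k (a + b) b (a - b + 1)) =
      (if v = 0 then 1 else 0 : k) • sumTabloids k (a + b) v := by
  ext Y
  have hY : Y.val = ∅ ↔ v = 0 := by rw [← Finset.card_eq_zero, Y.2]
  rw [psi_apply, coeffSum_hemmer_contains p hab hb _ (by rwa [Y.2]), Finsupp.smul_apply,
    sumTabloids_apply, smul_eq_mul, mul_one, if_congr hY rfl rfl]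

/-- Membership would force `c * C(n - z, b) = 1` for every `z < b`, and Pascal's rule at two
neighbouring values of `z` contradicts this. -/
theorem smul_sumTabloids_sub_hemmer_notMem (p : ℕ) [CharP k p] [Fact p.Prime] {β : ℕ}
    (hab : b ≤ a) (hb : b = p ^ β) (hdvd : ¬ b ∣ a + 1) (c : k) :
    c • sumTabloids k (a + b) b - sumTabloidsTop k (a + b) b (a - b + 1) ∉
      (specht k a b).toSubmodule := by
  intro h
  rw [mem_specht_iff k hab] at h
  have hc : ∀ z < b, c * ((a + b - z).choose b : k) = 1 := by
    intro z hz
    obtain ⟨Z, -, hZ⟩ := Finset.exists_subset_card_eq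
      (s := (Finset.univ : Finset (Fin (a + b)))) (n := z) (by simp; omega)
    have := h Z (by omega)
    rw [map_sub, map_sub, map_smul, map_smul, coeffSum_sumTabloids,
      coeffSum_hemmer p hab hb Z (by omega), hZ, smul_eq_mul] at this
    exact sub_eq_zero.1 this
  have hr := Nat.mod_lt (a + 1) (show b > 0 by rw [hb]; exact pow_pos (Fact.out : p.Prime).pos _)
  have hr0 : (a + 1) % b ≠ 0 := fun h0 => hdvd (Nat.dvd_of_mod_eq_zero h0)
  have hq := Nat.div_add_mod (a + 1) b
  set r := (a + 1) % b
  set q := (a + 1) / b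
  -- Both `r - 1` and `r` are admissible as `0 < r < b`. The choice makes `n - r` congruent to `b -
  -- 1` modulo `b`, so the Pascal increment `C(n - r, b - 1)` is `1` in `k` and `c` must vanish.
  have h1 := hc (r - 1) (by omega)
  have h2 := hc r hr
  obtain ⟨b', rfl⟩ : ∃ b', b = b' + 1 := ⟨b - 1, by omega⟩
  have e1 : a + (b' + 1) - (r - 1) = ((b' + 1) * q + b') + 1 := by omega
  have e2 : a + (b' + 1) - r = (b' + 1) * q + b' := by omega
  rw [e1, Nat.choose_succ_succ, Nat.cast_add, mul_add, ← e2, h2, e2, add_eq_right, hb,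
    cast_choose_pow_mul_add p β q b' (by omega), Nat.choose_self, Nat.cast_one, mul_one] at h1
  rw [h1, zero_mul] at h2
  exact zero_ne_one h2

theorem isHemmer_sumTabloidsTop (p : ℕ) [CharP k p] [Fact p.Prime] {β : ℕ}
    (hab : b ≤ a) (hb : b = p ^ β) (hdvd : ¬ b ∣ a + 1) :
    IsHemmer k a b (sumTabloidsTop k (a + b) b (a - b + 1)) := by
  refine ⟨fun v hv => ⟨_, psi_hemmer p hab hb hv⟩, ⟨0, ?_, 1, one_ne_zero, ?_⟩, ?_⟩
  · rw [hb]; exact pow_pos (Fact.out : p.Prime).pos _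
  · rw [psi_hemmer p hab hb (by rw [hb]; exact pow_pos (Fact.out : p.Prime).pos _), if_pos rfl]
  · rintro ⟨c, hc⟩
    exact smul_sumTabloids_sub_hemmer_notMem p hab hb hdvd c ((mem_specht_iff_psi hab _).2 hc)

end Hemmer

/-! ### The non-split extension and the cohomology class -/

section Extension

variable {k : Type*} [Field k] {a b : ℕ}

theorem permRep_hemmer_sub_mem (p : ℕ) [CharP k p] [Fact p.Prime] {β : ℕ} (hab : b ≤ a)
    (hb : b = p ^ β) (σ : Equiv.Perm (Fin (a + b))) :
    permRep k (a + b) b σ (sumTabloidsTop k (a + b) b (a - b + 1)) -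
      sumTabloidsTop k (a + b) b (a - b + 1) ∈ (specht k a b).toSubmodule := by
  rw [mem_specht_iff k hab]
  intro Z hZ
  rw [map_sub, map_sub, coeffSum_permRep, coeffSum_hemmer p hab hb _ hZ,
    coeffSum_hemmer p hab hb _ (by simpa using hZ), sub_self]

/-- No element of the coset of the Hemmer element modulo the Specht module is invariant. -/
theorem not_invariant_hemmer_sub (p : ℕ) [CharP k p] [Fact p.Prime] {β : ℕ} (hab : b ≤ a)
    (hb : b = p ^ β) (hdvd : ¬ b ∣ a + 1) {s : PermModule k (a + b) b}
    (hs : s ∈ (specht k a b).toSubmodule) :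
    ¬ ∀ σ, permRep k (a + b) b σ (sumTabloidsTop k (a + b) b (a - b + 1) - s) =
      sumTabloidsTop k (a + b) b (a - b + 1) - s := by
  intro h
  obtain ⟨c, hc⟩ := eq_smul_sumTabloids _ h
  refine smul_sumTabloids_sub_hemmer_notMem p hab hb hdvd c ?_
  rw [← hc, sub_sub_cancel_left]
  exact neg_mem hs

/-- The sum of the Specht module and the line through `u`, if `u` is invariant modulo the Specht
module. -/
def spechtExtension (u : PermModule k (a + b) b)
    (hu : ∀ σ, permRep k (a + b) b σ u - u ∈ (specht k a b).toSubmodule) :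
    Subrepresentation (permRep k (a + b) b) where
  toSubmodule := (specht k a b).toSubmodule ⊔ Submodule.span k {u}
  apply_mem_toSubmodule σ x hx := by
    obtain ⟨s, hs, w, hw, rfl⟩ := Submodule.mem_sup.1 hx
    obtain ⟨c, rfl⟩ := Submodule.mem_span_singleton.1 hw
    have : permRep k (a + b) b σ (s + c • u) =
        (permRep k (a + b) b σ s + c • (permRep k (a + b) b σ u - u)) + c • u := by
      rw [map_add, map_smul, smul_sub]; abel
    rw [this]
    exact Submodule.add_mem_sup (add_mem ((specht k a b).apply_mem_toSubmodule σ hs)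
      (Submodule.smul_mem _ c (hu σ))) hw

/-- The quotient map is the sum of all coefficients: invariant, zero on the Specht module and `1` at
`u`. A section would send `1` to an invariant element of the coset of `u`. -/
theorem isNonsplitExtensionByTrivial_spechtExtension (u : PermModule k (a + b) b)
    (hu : ∀ σ, permRep k (a + b) b σ u - u ∈ (specht k a b).toSubmodule) (hab : b ≤ a)
    (hb : 0 < b) (hu1 : coeffSum k ∅ ∅ (toSubsets k (a + b) b u) = 1)
    (hinv : ∀ s ∈ (specht k a b).toSubmodule, ¬ ∀ σ, permRep k (a + b) b σ (u - s) = u - s) :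
    IsNonsplitExtensionByTrivial (specht k a b) (spechtExtension u hu) := by
  let φ : PermModule k (a + b) b →ₗ[k] k := coeffSum k ∅ ∅ ∘ₗ toSubsets k (a + b) b
  have hφS : ∀ s ∈ (specht k a b).toSubmodule, φ s = 0 := fun s hs =>
    (mem_specht_iff k hab s).1 hs ∅ (by simpa using hb)
  have hφσ : ∀ σ x, φ (permRep k (a + b) b σ x) = φ x := fun σ x =>
    (coeffSum_permRep σ x ∅).trans (by rw [Finset.map_empty]; rfl)
  have hφu : ∀ s ∈ (specht k a b).toSubmodule, ∀ c : k, φ (s + c • u) = c := by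
    intro s hs c
    rw [map_add, map_smul, hφS s hs, show φ u = 1 from hu1, zero_add, smul_eq_mul, mul_one]
  have hE : ∀ x ∈ (spechtExtension u hu).toSubmodule, x - φ x • u ∈ (specht k a b).toSubmodule := by
    intro x hx
    obtain ⟨s, hs, w, hw, rfl⟩ := Submodule.mem_sup.1 hx
    obtain ⟨c, rfl⟩ := Submodule.mem_span_singleton.1 hw
    rwa [hφu s hs c, add_sub_cancel_right]
  have huE : u ∈ (spechtExtension u hu).toSubmodule :=
    Submodule.mem_sup_right (Submodule.mem_span_singleton_self u)
  refine ⟨fun x hx => Submodule.mem_sup_left hx,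
    (φ ∘ₗ (spechtExtension u hu).toSubmodule.subtype).intertwiningMap_of_isIntertwiningMap _ _
      fun σ x => hφσ σ x, fun c => ⟨c • ⟨u, huE⟩, ?_⟩, fun x => ?_, ?_⟩
  · change φ (c • u) = c
    simpa using hφu 0 (zero_mem _) c
  · change φ x = 0 ↔ _
    refine ⟨fun h => ?_, fun h => hφS _ h⟩
    have := hE x x.2
    rwa [h, zero_smul, sub_zero] at this
  · rintro ⟨s, hs⟩
    have h1 : φ (s 1) = 1 := hs 1
    have h2 := hE (s 1) (s 1).2
    rw [h1, one_smul] at h2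
    refine hinv _ (neg_mem h2) fun σ => ?_
    rw [neg_sub, sub_sub_cancel]
    exact (congrArg Subtype.val (LinearMap.congr_fun (s.isIntertwining' σ) (1 : k))).symm

/-- The cocycle `σ ↦ σu - u` is a coboundary in `M^(a,b)`; if it came from some `s` in the Specht
module, then `u - s` would be invariant. -/
theorem nontrivial_H1_spechtRep (u : PermModule k (a + b) b)
    (hu : ∀ σ, permRep k (a + b) b σ u - u ∈ (specht k a b).toSubmodule)
    (hinv : ∀ s ∈ (specht k a b).toSubmodule, ¬ ∀ σ, permRep k (a + b) b σ (u - s) = u - s) :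
    Nontrivial (groupCohomology (spechtRep k a b) 1) := by
  let x : groupCohomology.cocycles₁ (spechtRep k a b) :=
    ⟨fun g => (⟨permRep k (a + b) b g.down u - u, hu g.down⟩ : (specht k a b).toSubmodule),
    (groupCohomology.mem_cocycles₁_iff _).2 fun g h => by
      refine Subtype.ext ?_
      change permRep k (a + b) b (g.down * h.down) u - u =
        permRep k (a + b) b g.down (permRep k (a + b) b h.down u - u) +
          (permRep k (a + b) b g.down u - u)
      rw [map_mul, map_sub, Module.End.mul_apply]
      abel⟩
  refine ⟨⟨groupCohomology.H1π _ x, 0, fun h => ?_⟩⟩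
  rw [groupCohomology.H1π_eq_zero_iff] at h
  obtain ⟨s, hs⟩ := h
  refine hinv s.1 s.2 fun σ => ?_
  have h1 : permRep k (a + b) b σ s.1 - s.1 = permRep k (a + b) b σ u - u :=
    congrArg Subtype.val (congrFun hs (ULift.up σ))
  rw [map_sub, sub_eq_sub_iff_sub_eq_sub, ← h1]

end Extension

end TwoPartSpecht

end

theorem mainTheorem4 {k : Type*} [Field k] (p : ℕ) [CharP k p] (hp : 3 ≤ p) (a b β : ℕ)
    (hab : b ≤ a) (hb : b = p ^ β) (hval : p ^ padicValNat p (a + 1) < b) :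
    Nontrivial (groupCohomology (TwoPartSpecht.spechtRep k a b) 1) ∧
    TwoPartSpecht.IsHemmer k a b
      (TwoPartSpecht.sumTabloidsTop k (a + b) b (a - b + 1)) ∧
    ∃ E : Subrepresentation (TwoPartSpecht.permRep k (a + b) b),
      E.toSubmodule = (TwoPartSpecht.specht k a b).toSubmodule ⊔
        Submodule.span k {TwoPartSpecht.sumTabloidsTop k (a + b) b (a - b + 1)} ∧
      TwoPartSpecht.IsNonsplitExtensionByTrivial (TwoPartSpecht.specht k a b) E := by
  have : Fact p.Prime := ⟨(CharP.char_is_prime_or_zero k p).resolve_right (by omega)⟩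
  -- For `b = p^β` the bound says that the valuation of `a + 1` is less than `β`.
  have hdvd : ¬ b ∣ a + 1 := by
    rw [hb] at hval ⊢
    rw [padicValNat_dvd_iff_le (Nat.succ_ne_zero a), not_le]
    exact (Nat.pow_lt_pow_iff_right (by omega)).1 hval
  have hb0 : 0 < b := (Nat.zero_le _).trans_lt hval
  have hu := TwoPartSpecht.permRep_hemmer_sub_mem (k := k) p hab hb
  have hinv := fun s hs =>
    TwoPartSpecht.not_invariant_hemmer_sub (k := k) p hab hb hdvd (s := s) hs
  exact ⟨TwoPartSpecht.nontrivial_H1_spechtRep _ hu hinv,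
    TwoPartSpecht.isHemmer_sumTabloidsTop p hab hb hdvd,
    TwoPartSpecht.spechtExtension _ hu, rfl,
    TwoPartSpecht.isNonsplitExtensionByTrivial_spechtExtension _ hu hab hb0
      (TwoPartSpecht.coeffSum_hemmer p hab hb ∅ (by simpa using hb0)) hinv⟩
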